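/- **Setting.** Let $D\ge 0$, let $\Gamma\subset\mathbb Z^D$ be a finite lattice with the graph distance $\mathrm{dist}(u,v)=|u-v|_1$, and attach to each site a copy of $\mathbb C^q$ (qubits: $q=2$). A *local Hamiltonian* on $\Gamma$ is $H=\sum_{X\subseteq\Gamma}H_X$, where each $H_X$ is a Hermitian operator on $\bigotimes_{x\in\Gamma}\mathbb C^q$ that acts as the identity outside $X$, satisfies $\|H_X\|\le 1$ (spectral norm), and is $0$ if $X$ contains two sites at distance larger than $1$. For a region $Y\subseteq\Gamma$ and $t\in\mathbb R$ put $H_Y=\sum_{X\subseteq Y}H_X$, $U_Y=e^{-iH_Yt}$, $\mathcal U_Y(\rho)=U_Y\rho\,U_Y^\dagger$ and $\mathcal U_Y^\dagger(\rho)=U_Y^\dagger\rho\,U_Y$; products of channels are compositions. Let $\mathrm{dist}(A,C)=\min_{a\in A,\,c\in C}\mathrm{dist}(a,c)$ (read as $0$ if $A$ or $C$ is empty). The diamond norm of a linear map $\Phi$ on matrices is $\|\Phi\|_\diamond=\sup_{k}\sup_{\|\rho\|_1\le 1}\|(\Phi\otimes\mathrm{id}_k)(\rho)\|_1$, where $\|\cdot\|_1$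 is the sum of the singular values and $k$ runs over the ancilla dimensions. **Lemma.** For every $D$ there is a constant $\mu>0$, depending only on $D$, such that for every $t\in\mathbb R$ there is a constant $K>0$, depending only on $D$ and $t$, with the following property. For every finite $\Gamma\subset\mathbb Z^D$, every $q$, every local Hamiltonian $H$ on $\Gamma$ and all pairwise disjoint regions $A,B,C\subseteq\Gamma$, $$\big\|\mathcal U_{A\cup B}\,\mathcal U_B^\dagger\,\mathcal U_{B\cup C}-\mathcal U_{A\cup B\cup C}\big\|_\diamond\;\le\;K\,e^{-\mu\,\mathrm{dist}(A,C)}\sum_{X:\,bd(AB,C)}\|H_X\|,$$ where $X:bd(AB,C)$ means $X\subseteq A\cup B\cup C$, $X\not\subseteq A\cup B$ and $X\not\subseteq C$. Moreover, for any two unitary matrices $U,V$ of the same finite size, with channels $\mathcal U(\rho)=U\rho\,U^\dagger$ and $\mathcal V(\rho)=V\rho\,V^\dagger$, one has $\|\mathcal U-\mathcal V\|_\diamond\le 2\|U-V\|_\infty$, where $\|\cdot\|_\infty$ is the spectral norm. -/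

import Mathlib

-- `‖M‖` for a matrix `M` is the spectral norm (the operator norm for the Euclidean norm).
open scoped Matrix.Norms.L2Operator

noncomputable section

namespace LocalEvolution

/-! ### Lattice geometry -/

/-- A site of the lattice `ℤ^D`. -/
abbrev Site (D : ℕ) : Type := Fin D → ℤ

/-- The graph distance `|u - v|₁` on `ℤ^D`. -/
def siteDist {D : ℕ} (u v : Site D) : ℕ := ∑ i, (u i - v i).natAbs

/-- `dist(A, C) = min_{a ∈ A, c ∈ C} dist(a, c)` for regions of a finite lattice `Γ ⊆ ℤ^D`
(with the value `0` if one of the two regions is empty). -/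
def regionDist {D : ℕ} {Γ : Finset (Site D)} (A C : Finset Γ) : ℕ :=
  sInf {d | ∃ a ∈ A, ∃ c ∈ C, siteDist (a : Site D) (c : Site D) = d}

/-! ### Operators on the lattice

To every site of `Γ` belongs a copy of `ℂ^q`. The space `⨂_{x ∈ Γ} ℂ^q` has the standard basis
indexed by the configurations `Γ → Fin q`; its operators are matrices over this index set. -/

/-- Configurations of the sites in `Γ`: they label the standard basis of `⨂_{x ∈ Γ} ℂ^q`. -/
abbrev Config {D : ℕ} (Γ : Finset (Site D)) (q : ℕ) : Type := Γ → Fin q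

/-- Operators on `⨂_{x ∈ Γ} ℂ^q`. -/
abbrev Operator {D : ℕ} (Γ : Finset (Site D)) (q : ℕ) : Type :=
  Matrix (Config Γ q) (Config Γ q) ℂ

/-- `M` is supported on `X`, that is, `M = h ⊗ 𝟙` for an operator `h` on the sites in `X` and the
identity on the sites outside `X`. -/
def IsSupportedOn {D q : ℕ} {Γ : Finset (Site D)} (X : Finset Γ) (M : Operator Γ q) : Prop :=
  ∃ h : Matrix (X → Fin q) (X → Fin q) ℂ, ∀ σ τ : Config Γ q,
    ((∀ x, x ∉ X → σ x = τ x) → M σ τ = h (fun x => σ x) (fun x => τ x)) ∧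
    ((∃ x, x ∉ X ∧ σ x ≠ τ x) → M σ τ = 0)

/-- A (geometrically) local Hamiltonian `H = ∑_{X ⊆ Γ} H_X` on the finite lattice `Γ ⊆ ℤ^D`: each
`H_X` is Hermitian, acts as the identity outside `X`, vanishes if `X` has diameter larger than `1`,
and has spectral norm at most `1`. -/
structure LocalHamiltonian {D : ℕ} (Γ : Finset (Site D)) (q : ℕ) where
  /-- The terms `H_X`. -/
  term : Finset Γ → Operator Γ q
  isHermitian : ∀ X, (term X).IsHermitian
  supported : ∀ X, IsSupportedOn X (term X)
  range_one : ∀ X : Finset Γ,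
    (∃ x ∈ X, ∃ y ∈ X, 1 < siteDist (x : Site D) (y : Site D)) → term X = 0
  norm_le_one : ∀ X, ‖term X‖ ≤ 1

namespace LocalHamiltonian

variable {D q : ℕ} {Γ : Finset (Site D)} (H : LocalHamiltonian Γ q)

/-- `H_Y = ∑_{X ⊆ Y} H_X`: the terms of the Hamiltonian that are supported on the region `Y`. -/
def restrict (Y : Finset Γ) : Operator Γ q := ∑ X ∈ Y.powerset, H.term X

/-- The time evolution operator `U_Y = exp(-i H_Y t)` of the region `Y`. -/
def evolution (t : ℝ) (Y : Finset Γ) : Operator Γ q :=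
  NormedSpace.exp ((-(Complex.I * (t : ℂ))) • H.restrict Y)

/-- `∑_{X : bd(AB, C)} ‖H_X‖`: the sum over all `X ⊆ A ∪ B ∪ C` with `X ⊄ A ∪ B` and `X ⊄ C`. -/
def boundaryNorm (A B C : Finset Γ) : ℝ :=
  ∑ X ∈ (A ∪ B ∪ C).powerset with ¬ X ⊆ A ∪ B ∧ ¬ X ⊆ C, ‖H.term X‖

end LocalHamiltonian

/-! ### Channels and the diamond norm -/

section Channels

variable {n : Type*} [Fintype n] [DecidableEq n]

/-- The map `ρ ↦ V ρ V†` on matrices. -/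
def conjChannel (V : Matrix n n ℂ) : Matrix n n ℂ →ₗ[ℂ] Matrix n n ℂ where
  toFun ρ := V * ρ * V.conjTranspose
  map_add' ρ σ := by rw [mul_add, add_mul]
  map_smul' c ρ := by simp

/-- The trace norm (Schatten 1-norm) `‖M‖₁`: the sum of the singular values of `M`. -/
def traceNorm (M : Matrix n n ℂ) : ℝ :=
  ∑ i ∈ Finset.range (Fintype.card n), (Matrix.toEuclideanLin M).singularValues i

/-- `(Φ ⊗ id_k)(ρ)`, where `id_k` is the identity map on the matrices of an ancilla `ℂ^k`: the map
`Φ` acts on each of the blocks `ρ_{(·, a), (·, b)}`. -/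
def ampliate (Φ : Matrix n n ℂ →ₗ[ℂ] Matrix n n ℂ) (k : ℕ)
    (ρ : Matrix (n × Fin k) (n × Fin k) ℂ) : Matrix (n × Fin k) (n × Fin k) ℂ :=
  Matrix.of fun x y => Φ (Matrix.of fun i j => ρ (i, x.2) (j, y.2)) x.1 y.1

/-- The diamond norm (completely bounded trace norm): the supremum of `‖(Φ ⊗ id_k)(ρ)‖₁` over all
ancillas `ℂ^k` and all `ρ` with `‖ρ‖₁ ≤ 1`. -/
def diamondNorm (Φ : Matrix n n ℂ →ₗ[ℂ] Matrix n n ℂ) : ENNReal :=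
  ⨆ (k : ℕ) (ρ : Matrix (n × Fin k) (n × Fin k) ℂ) (_ : traceNorm ρ ≤ 1),
    ENNReal.ofReal (traceNorm (ampliate Φ k ρ))

end Channels

end LocalEvolution

end

noncomputable section

namespace LocalEvolution

/-! ### Duality for the trace norm -/

section TraceDuality

open Module

variable {E : Type*} [NormedAddCommGroup E] [InnerProductSpace ℂ E] [FiniteDimensional ℂ E]

/-! The diamond norm is reduced to the spectral norm by duality: `‖M‖₁` is the maximum of `|tr (W
M)|` over `‖W‖ ≤ 1`. For a difference of two unitary conjugations, cyclicity of the trace leaves one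
factor `U - V` and contractions in each of two terms, and tensoring with an ancilla does not
increase `‖U - V‖` (`diamondNorm_conjChannel_sub_le`).

It remains to bound `U_AB U_B† U_BC - U_ABC` in spectral norm. Its norm is that of `U_ABC† U_AB -
U_BC† U_B`, a difference of two interaction-picture propagators. By Duhamel
(`norm_propagator_sub_le`) this is at most the integral of the difference of their
Heisenberg-evolved perturbations. The part of the perturbation inside `C` commutes with both
generators and cancels, so only terms across the boundary of `C` remain, evolved once with `H_AB`
and once with `H_B`. These terms lie near `C`, hence far from `A`, and the two evolutions almost
agree on them.

That last fact is a Lieb–Robinson bound (`norm_heisenberg_union_sub_le`), proved by induction on the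
distance `n` with the same Duhamel estimate. Each step moves from an observable to the boundedly
many terms touching it, one unit closer to `A`, and gains one integration in time. The resulting `x
^ n / n!` beats every exponential, so the decay rate 1 works for all `t`, with the time dependence
in the constant. -/

theorem norm_trace_comp_le_sum_singularValues (W : E →L[ℂ] E) (T : E →ₗ[ℂ] E) :
    ‖LinearMap.trace ℂ E ((W : E →ₗ[ℂ] E) ∘ₗ T)‖
      ≤ ‖W‖ * ∑ i ∈ Finset.range (finrank ℂ E), T.singularValues i := by
  set b := T.isSymmetric_adjoint_comp_self.eigenvectorBasis rfl with hb
  -- `b` diagonalises `T† T`, so it consists of right singular vectors.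
  have key : ∀ i : Fin (finrank ℂ E), ‖T (b i)‖ = T.singularValues i := by
    intro i
    have h : ‖T (b i)‖ ^ 2 = T.singularValues i ^ 2 := by
      rw [T.sq_singularValues_fin rfl, ← inner_self_eq_norm_sq (𝕜 := ℂ),
        ← LinearMap.adjoint_inner_right, ← LinearMap.comp_apply,
        hb, LinearMap.IsSymmetric.apply_eigenvectorBasis]
      rw [← hb, inner_smul_right,
        inner_self_eq_norm_sq_to_K, b.orthonormal.1 i]
      simp
    exact (pow_left_inj₀ (norm_nonneg _) (T.singularValues_nonneg i) two_ne_zero).1 h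
  rw [LinearMap.trace_eq_sum_inner _ b, Finset.sum_range, Finset.mul_sum]
  refine (norm_sum_le _ _).trans (Finset.sum_le_sum fun i _ => ?_)
  calc ‖inner ℂ (b i) (W (T (b i)))‖ ≤ ‖b i‖ * ‖W (T (b i))‖ := norm_inner_le_norm _ _
    _ ≤ 1 * (‖W‖ * ‖T (b i)‖) := by
        rw [b.orthonormal.1 i]; gcongr; exact W.le_opNorm _
    _ = _ := by rw [one_mul, key]

theorem exists_trace_comp_eq_sum_singularValues (T : E →ₗ[ℂ] E) :
    ∃ W : E →L[ℂ] E, ‖W‖ ≤ 1 ∧ LinearMap.trace ℂ E ((W : E →ₗ[ℂ] E) ∘ₗ T)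
      = ((∑ i ∈ Finset.range (finrank ℂ E), T.singularValues i : ℝ) : ℂ) := by
  set b := T.isSymmetric_adjoint_comp_self.eigenvectorBasis rfl with hb
  have hin : ∀ i j : Fin (finrank ℂ E), inner ℂ (T (b i)) (T (b j))
      = if i = j then (T.singularValues j : ℂ) ^ 2 else 0 := by
    intro i j
    rw [← LinearMap.adjoint_inner_right, ← LinearMap.comp_apply, hb,
      LinearMap.IsSymmetric.apply_eigenvectorBasis, ← T.sq_singularValues_fin rfl,
      inner_smul_right, ← hb, orthonormal_iff_ite.1 b.orthonormal]
    split_ifs <;> simp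
  let P := {i : Fin (finrank ℂ E) // T.singularValues i ≠ 0}
  let u : P → E := fun i => ((T.singularValues i.1 : ℂ)⁻¹) • T (b i.1)
  have hu : Orthonormal ℂ u := by
    classical
    rw [orthonormal_iff_ite]
    rintro ⟨i, hi⟩ ⟨j, hj⟩
    have hj' : (T.singularValues j : ℂ) ≠ 0 := by exact_mod_cast hj
    simp only [u, inner_smul_left, inner_smul_right, hin]
    by_cases h : i = j
    · subst h
      simp only [map_inv₀, Complex.conj_ofReal, if_true]
      field_simp
    · rw [if_neg h, if_neg fun h' => h (congrArg Subtype.val h')]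
      simp
  -- The adjoint of the polar part of `T`: left singular vectors `u i` go back to `b i`, their
  -- complement goes to 0. It is a contraction by Bessel's inequality, and `W T` has trace the sum
  -- of the singular values.
  let W : E →ₗ[ℂ] E := ∑ i : P, (LinearMap.toSpanSingleton ℂ E (b i.1)) ∘ₗ (innerₛₗ ℂ (u i))
  have hW : ∀ x, W x = ∑ i : P, inner ℂ (u i) x • b i.1 := by
    intro x; simp [W]
  have hWn : ∀ x, ‖W x‖ ≤ 1 * ‖x‖ := by
    intro x
    rw [one_mul]
    refine le_of_sq_le_sq ?_ (norm_nonneg _)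
    have ho : Orthonormal ℂ (fun i : P => b i.1) :=
      b.orthonormal.comp _ Subtype.val_injective
    rw [hW, ← inner_self_eq_norm_sq (𝕜 := ℂ), ho.inner_sum]
    have := hu.sum_inner_products_le x (s := Finset.univ)
    refine le_trans (le_of_eq ?_) this
    rw [map_sum]
    refine Finset.sum_congr rfl fun i _ => ?_
    rw [RCLike.conj_mul]
    norm_cast
  refine ⟨W.mkContinuous 1 hWn, LinearMap.mkContinuous_norm_le _ zero_le_one _, ?_⟩
  rw [LinearMap.trace_eq_sum_inner _ b, Finset.sum_range, Complex.ofReal_sum]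
  refine Finset.sum_congr rfl fun j _ => ?_
  change inner ℂ (b j) (W (T (b j))) = _
  rw [hW, inner_sum]
  have hterm : ∀ i : P, inner ℂ (b j) (inner ℂ (u i) (T (b j)) • b i.1)
      = if i.1 = j then (T.singularValues j : ℂ) else 0 := by
    rintro ⟨i, hi⟩
    have hi' : (T.singularValues i : ℂ) ≠ 0 := by exact_mod_cast hi
    simp only [u, inner_smul_left, inner_smul_right, hin,
      orthonormal_iff_ite.1 b.orthonormal]
    by_cases h : i = j
    · subst h
      simp only [map_inv₀, Complex.conj_ofReal, if_true]
      field_simp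
    · simp [h]
  rw [Finset.sum_congr rfl fun i _ => hterm i]
  by_cases hj : T.singularValues j = 0
  · simp [hj]
  · rw [Finset.sum_eq_single (⟨j, hj⟩ : P)]
    · simp
    · rintro ⟨i, hi⟩ _ h
      rw [if_neg]
      intro h'
      exact h (Subtype.ext h')
    · simp

end TraceDuality

/-! ### Distance of unitary channels -/

section Channels

variable {n : Type*} [Fintype n] [DecidableEq n]

theorem trace_toEuclideanCLM (M : Matrix n n ℂ) :
    LinearMap.trace ℂ (EuclideanSpace ℂ n)
      (Matrix.toEuclideanCLM (n := n) (𝕜 := ℂ) M : EuclideanSpace ℂ n →ₗ[ℂ] EuclideanSpace ℂ n)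
      = M.trace := by
  rw [Matrix.coe_toEuclideanCLM_eq_toEuclideanLin, Matrix.toEuclideanLin_eq_toLin_orthonormal,
    Matrix.trace_toLin_eq]

theorem norm_trace_mul_le_traceNorm (W M : Matrix n n ℂ) :
    ‖(W * M).trace‖ ≤ ‖W‖ * traceNorm M := by
  have h := norm_trace_comp_le_sum_singularValues (Matrix.toEuclideanCLM (n := n) (𝕜 := ℂ) W)
    (Matrix.toEuclideanLin M)
  rw [finrank_euclideanSpace] at h
  rw [← trace_toEuclideanCLM, map_mul]
  exact h

theorem exists_trace_mul_eq_traceNorm (M : Matrix n n ℂ) :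
    ∃ W : Matrix n n ℂ, ‖W‖ ≤ 1 ∧ (W * M).trace = (traceNorm M : ℂ) := by
  obtain ⟨W, hW, h⟩ := exists_trace_comp_eq_sum_singularValues (Matrix.toEuclideanLin M)
  rw [finrank_euclideanSpace] at h
  obtain ⟨W, rfl⟩ := (Matrix.toEuclideanCLM (n := n) (𝕜 := ℂ)).surjective W
  refine ⟨W, hW, ?_⟩
  rw [← trace_toEuclideanCLM, map_mul]
  exact h

theorem norm_le_one_of_mem_unitaryGroup {U : Matrix n n ℂ} (hU : U ∈ Matrix.unitaryGroup n ℂ) :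
    ‖U‖ ≤ 1 := by
  rcases subsingleton_or_nontrivial (Matrix n n ℂ) with h | h
  · rw [Subsingleton.elim U 0, norm_zero]; exact zero_le_one
  · exact (CStarRing.norm_of_mem_unitary hU).le

theorem traceNorm_conj_sub_conj_le (U V ρ : Matrix n n ℂ) (hU : ‖U‖ ≤ 1) (hV : ‖V‖ ≤ 1) :
    traceNorm (U * ρ * U.conjTranspose - V * ρ * V.conjTranspose)
      ≤ 2 * ‖U - V‖ * traceNorm ρ := by
  have hρ : 0 ≤ traceNorm ρ := Finset.sum_nonneg fun i _ => LinearMap.singularValues_nonneg _ i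
  obtain ⟨W, hW, h⟩ := exists_trace_mul_eq_traceNorm
    (U * ρ * U.conjTranspose - V * ρ * V.conjTranspose)
  have e : (W * (U * ρ * U.conjTranspose - V * ρ * V.conjTranspose)).trace
      = ((U.conjTranspose * W * (U - V) + (U - V).conjTranspose * W * V) * ρ).trace := by
    have e1 : W * (U * ρ * U.conjTranspose - V * ρ * V.conjTranspose)
        = (W * (U - V) * ρ) * U.conjTranspose + (W * V * ρ) * (U - V).conjTranspose := by
      rw [Matrix.conjTranspose_sub]; noncomm_ring
    rw [e1, Matrix.trace_add, Matrix.trace_mul_comm, Matrix.trace_mul_comm (W * V * ρ),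
      ← Matrix.trace_add]
    congr 1
    noncomm_ring
  have h1 : traceNorm (U * ρ * U.conjTranspose - V * ρ * V.conjTranspose)
      ≤ ‖(W * (U * ρ * U.conjTranspose - V * ρ * V.conjTranspose)).trace‖ := by
    rw [h, Complex.norm_real]; exact le_abs_self _
  refine h1.trans ?_
  rw [e]
  refine (norm_trace_mul_le_traceNorm _ _).trans (mul_le_mul_of_nonneg_right ?_ hρ)
  have a1 : ‖U.conjTranspose * W * (U - V)‖ ≤ 1 * 1 * ‖U - V‖ := by
    refine (norm_mul_le _ _).trans ?_
    gcongr
    refine (norm_mul_le _ _).trans ?_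
    rw [Matrix.l2_opNorm_conjTranspose]
    gcongr
  have a2 : ‖(U - V).conjTranspose * W * V‖ ≤ ‖U - V‖ * 1 * 1 := by
    refine (norm_mul_le _ _).trans ?_
    gcongr
    refine (norm_mul_le _ _).trans ?_
    rw [Matrix.l2_opNorm_conjTranspose]
    gcongr
  linarith [norm_add_le (U.conjTranspose * W * (U - V)) ((U - V).conjTranspose * W * V)]

open scoped Kronecker in
theorem ampliate_conjChannel (U : Matrix n n ℂ) (k : ℕ) (ρ : Matrix (n × Fin k) (n × Fin k) ℂ) :
    ampliate (conjChannel U) k ρ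
      = (U ⊗ₖ (1 : Matrix (Fin k) (Fin k) ℂ)) * ρ
        * (U ⊗ₖ (1 : Matrix (Fin k) (Fin k) ℂ)).conjTranspose := by
  ext ⟨i, a⟩ ⟨j, b⟩
  simp only [ampliate, conjChannel, LinearMap.coe_mk, AddHom.coe_mk, Matrix.of_apply,
    Matrix.mul_apply, Matrix.conjTranspose_apply, Fintype.sum_prod_type,
    Matrix.kroneckerMap_apply, Matrix.one_apply]
  simp [apply_ite (starRingEnd ℂ)]

open scoped Kronecker in
-- `A ⊗ 1` acts by `A` separately on each slice with fixed ancilla index, and the squared norms of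
-- the slices add up.
theorem norm_kronecker_one_le (A : Matrix n n ℂ) (k : ℕ) :
    ‖A ⊗ₖ (1 : Matrix (Fin k) (Fin k) ℂ)‖ ≤ ‖A‖ := by
  rw [Matrix.cstar_norm_def (A ⊗ₖ (1 : Matrix (Fin k) (Fin k) ℂ))]
  refine ContinuousLinearMap.opNorm_le_bound _ (norm_nonneg _) fun x => ?_
  refine le_of_sq_le_sq ?_ (by positivity)
  have hA : ∀ a : Fin k, ∑ i, ‖∑ j, A i j * x (j, a)‖ ^ 2 ≤ ‖A‖ ^ 2 * ∑ i, ‖x (i, a)‖ ^ 2 := by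
    intro a
    have h := (Matrix.toEuclideanCLM (n := n) (𝕜 := ℂ) A).le_opNorm
      (WithLp.toLp 2 fun i => x (i, a))
    have h2 := pow_le_pow_left₀ (norm_nonneg _) h 2
    rw [mul_pow, EuclideanSpace.norm_sq_eq, EuclideanSpace.norm_sq_eq,
      ← Matrix.cstar_norm_def] at h2
    simpa [Matrix.toEuclideanCLM_toLp, Matrix.mulVec, dotProduct] using h2
  rw [mul_pow, EuclideanSpace.norm_sq_eq, EuclideanSpace.norm_sq_eq, Fintype.sum_prod_type_right,
    Fintype.sum_prod_type_right, Finset.mul_sum]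
  refine Finset.sum_le_sum fun a _ => le_trans (le_of_eq ?_) (hA a)
  refine Finset.sum_congr rfl fun i _ => ?_
  simp [Matrix.ofLp_toEuclideanCLM, Matrix.mulVec, dotProduct, Fintype.sum_prod_type,
    Matrix.one_apply]

open scoped Kronecker in
theorem diamondNorm_conjChannel_sub_le {U V : Matrix n n ℂ} (hU : U ∈ Matrix.unitaryGroup n ℂ)
    (hV : V ∈ Matrix.unitaryGroup n ℂ) :
    diamondNorm (conjChannel U - conjChannel V) ≤ ENNReal.ofReal (2 * ‖U - V‖) := by
  refine iSup_le fun k => iSup_le fun ρ => iSup_le fun hρ => ENNReal.ofReal_le_ofReal ?_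
  have e : ampliate (conjChannel U - conjChannel V) k ρ
      = ampliate (conjChannel U) k ρ - ampliate (conjChannel V) k ρ := by
    ext x y; rfl
  have hρ' : 0 ≤ traceNorm ρ := Finset.sum_nonneg fun i _ => LinearMap.singularValues_nonneg _ i
  rw [e, ampliate_conjChannel, ampliate_conjChannel]
  refine (traceNorm_conj_sub_conj_le _ _ ρ
    ((norm_kronecker_one_le U k).trans (norm_le_one_of_mem_unitaryGroup hU))
    ((norm_kronecker_one_le V k).trans (norm_le_one_of_mem_unitaryGroup hV))).trans ?_
  have e2 : U ⊗ₖ (1 : Matrix (Fin k) (Fin k) ℂ) - V ⊗ₖ (1 : Matrix (Fin k) (Fin k) ℂ)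
      = (U - V) ⊗ₖ (1 : Matrix (Fin k) (Fin k) ℂ) := by
    ext x y
    simp [sub_mul]
  rw [e2]
  calc _ ≤ 2 * ‖U - V‖ * 1 := by
        gcongr
        exact norm_kronecker_one_le _ k
    _ = _ := mul_one _

theorem conjChannel_comp (U V : Matrix n n ℂ) :
    conjChannel U ∘ₗ conjChannel V = conjChannel (U * V) := by
  refine LinearMap.ext fun ρ => ?_
  simp [conjChannel, Matrix.conjTranspose_mul, Matrix.mul_assoc]

end Channels

/-! ### Comparison of one-parameter unitary groups in a C⋆-algebra -/

section CStar

open NormedSpace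

variable {𝔸 : Type*} [CStarAlgebra 𝔸]

/-- The Heisenberg evolution `exp(sK) O exp(-sK)`. -/
def heisenberg (K : 𝔸) (s : ℝ) (O : 𝔸) : 𝔸 := exp (s • K) * O * exp (s • (-K))

theorem exp_smul_mul_exp_smul_neg (K : 𝔸) (s : ℝ) : exp (s • K) * exp (s • (-K)) = 1 := by
  have : NormedAlgebra ℚ 𝔸 := NormedAlgebra.restrictScalars ℚ ℝ 𝔸
  rw [smul_neg, ← exp_add_of_commute (Commute.refl _).neg_right, add_neg_cancel, exp_zero]

theorem exp_smul_neg_mul_exp_smul (K : 𝔸) (s : ℝ) : exp (s • (-K)) * exp (s • K) = 1 := by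
  simpa using exp_smul_mul_exp_smul_neg (-K) s

theorem smul_mem_skewAdjoint {K : 𝔸} (hK : K ∈ skewAdjoint 𝔸) (s : ℝ) :
    s • K ∈ skewAdjoint 𝔸 := skewAdjoint.smul_mem s hK

theorem exp_smul_mem_unitary {K : 𝔸} (hK : K ∈ skewAdjoint 𝔸) (s : ℝ) :
    exp (s • K) ∈ unitary 𝔸 := by
  have : NormedAlgebra ℚ 𝔸 := NormedAlgebra.restrictScalars ℚ ℝ 𝔸
  exact exp_mem_unitary_of_mem_skewAdjoint (smul_mem_skewAdjoint hK s)

theorem star_exp_smul {K : 𝔸} (hK : K ∈ skewAdjoint 𝔸) (s : ℝ) :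
    star (exp (s • K)) = exp (s • (-K)) := by
  have : NormedAlgebra ℚ 𝔸 := NormedAlgebra.restrictScalars ℚ ℝ 𝔸
  rw [star_exp, star_smul, skewAdjoint.mem_iff.1 hK, star_trivial]

theorem norm_heisenberg {K : 𝔸} (hK : K ∈ skewAdjoint 𝔸) (s : ℝ) (O : 𝔸) :
    ‖heisenberg K s O‖ = ‖O‖ := by
  rw [heisenberg, CStarRing.norm_mul_mem_unitary _ (exp_smul_mem_unitary (neg_mem hK) s),
    CStarRing.norm_mem_unitary_mul _ (exp_smul_mem_unitary hK s)]

theorem heisenberg_add (K : 𝔸) (s : ℝ) (O P : 𝔸) :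
    heisenberg K s (O + P) = heisenberg K s O + heisenberg K s P := by
  simp only [heisenberg, mul_add, add_mul]

theorem heisenberg_neg (K : 𝔸) (s : ℝ) (O : 𝔸) :
    heisenberg K s (-O) = -heisenberg K s O := by
  simp only [heisenberg, mul_neg, neg_mul]

theorem heisenberg_smul (K : 𝔸) (s : ℝ) (c : ℂ) (O : 𝔸) :
    heisenberg K s (c • O) = c • heisenberg K s O := by
  simp only [heisenberg, mul_smul_comm, smul_mul_assoc]

theorem heisenberg_sum {ι : Type*} (K : 𝔸) (s : ℝ) (F : Finset ι) (O : ι → 𝔸) :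
    heisenberg K s (∑ i ∈ F, O i) = ∑ i ∈ F, heisenberg K s (O i) := by
  simp only [heisenberg, Finset.mul_sum, Finset.sum_mul]

theorem heisenberg_of_commute {K O : 𝔸} (h : Commute K O) (s : ℝ) : heisenberg K s O = O := by
  have : NormedAlgebra ℚ 𝔸 := NormedAlgebra.restrictScalars ℚ ℝ 𝔸
  rw [heisenberg, ((h.smul_left s).exp_left).eq, mul_assoc, exp_smul_mul_exp_smul_neg, mul_one]

/-- The interaction-picture propagator `exp(s(K - V)) exp(-sK)`. -/
def propagator (K V : 𝔸) (s : ℝ) : 𝔸 := exp (s • (K - V)) * exp (s • (-K))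

theorem propagator_mem_unitary {K V : 𝔸} (hK : K ∈ skewAdjoint 𝔸) (hV : V ∈ skewAdjoint 𝔸)
    (s : ℝ) : propagator K V s ∈ unitary 𝔸 :=
  mul_mem (exp_smul_mem_unitary (sub_mem hK hV) s) (exp_smul_mem_unitary (neg_mem hK) s)

theorem star_propagator {K V : 𝔸} (hK : K ∈ skewAdjoint 𝔸) (hV : V ∈ skewAdjoint 𝔸) (s : ℝ) :
    star (propagator K V s) = exp (s • K) * exp (s • (V - K)) := by
  rw [propagator, star_mul, star_exp_smul (neg_mem hK), star_exp_smul (sub_mem hK hV), neg_neg,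
    neg_sub]

/-- Duhamel estimate: `P₁ P₂† - 1` vanishes at time 0, and its derivative is the difference of the
evolved perturbations between two unitaries. The power `s ^ m` lets the factorial build up under
iteration. -/
theorem norm_propagator_sub_le {K₁ K₂ V₁ V₂ : 𝔸} (hK₁ : K₁ ∈ skewAdjoint 𝔸)
    (hK₂ : K₂ ∈ skewAdjoint 𝔸) (hV₁ : V₁ ∈ skewAdjoint 𝔸) (hV₂ : V₂ ∈ skewAdjoint 𝔸)
    {c r : ℝ} {m : ℕ} (hr : 0 ≤ r)
    (h : ∀ s, 0 ≤ s → s ≤ r → ‖heisenberg K₁ s V₁ - heisenberg K₂ s V₂‖ ≤ c * s ^ m) :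
    ‖propagator K₁ V₁ r - propagator K₂ V₂ r‖ ≤ c * r ^ (m + 1) / (m + 1) := by
  let f : ℝ → 𝔸 := fun s => propagator K₁ V₁ s * star (propagator K₂ V₂ s) - 1
  let f' : ℝ → 𝔸 := fun s => -(propagator K₁ V₁ s *
    (heisenberg K₁ s V₁ - heisenberg K₂ s V₂) * star (propagator K₂ V₂ s))
  have hf : ∀ s, HasDerivAt f (f' s) s := by
    intro s
    have h1 := ((hasDerivAt_exp_smul_const (K₁ - V₁) s).mul
      (hasDerivAt_exp_smul_const' (-K₁) s)).mul
      ((hasDerivAt_exp_smul_const K₂ s).mul (hasDerivAt_exp_smul_const' (V₂ - K₂) s))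
    have h2 := h1.sub_const 1
    have e : f = fun s => (exp (s • (K₁ - V₁)) * exp (s • (-K₁)))
        * (exp (s • K₂) * exp (s • (V₂ - K₂))) - 1 := by
      funext s
      simp only [f]
      rw [star_propagator hK₂ hV₂, propagator]
    rw [e]
    refine h2.congr_deriv ?_
    simp only [f', Pi.mul_apply]
    rw [star_propagator hK₂ hV₂, propagator, heisenberg, heisenberg]
    have i1 := exp_smul_neg_mul_exp_smul K₁ s
    have i2 := exp_smul_neg_mul_exp_smul K₂ s
    generalize exp (s • (K₁ - V₁)) = a at *
    generalize exp (s • (-K₁)) = b at *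
    generalize exp (s • K₁) = b' at *
    generalize exp (s • K₂) = d at *
    generalize exp (s • (-K₂)) = d' at *
    generalize exp (s • (V₂ - K₂)) = e at *
    have r1 : -(a * b * (b' * V₁ * b - d * V₂ * d') * (d * e))
        = -(a * (b * b') * V₁ * b * d * e) + a * b * d * V₂ * (d' * d) * e := by noncomm_ring
    rw [r1, i1, i2]
    noncomm_ring
  have hB : ∀ x : ℝ, HasDerivAt (fun s : ℝ => c * s ^ (m + 1) / (m + 1)) (c * x ^ m) x := by
    intro x
    have := ((hasDerivAt_pow (m + 1) x).const_mul c).div_const ((m : ℝ) + 1)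
    refine this.congr_deriv ?_
    have : (m : ℝ) + 1 ≠ 0 := by positivity
    rw [Nat.add_sub_cancel]
    push_cast
    field_simp
  have hfr : ‖f r‖ ≤ c * r ^ (m + 1) / (m + 1) := by
    refine image_norm_le_of_norm_deriv_right_le_deriv_boundary
      (f := f) (f' := f') (a := 0) (b := r)
      (fun s _ => (hf s).continuousAt.continuousWithinAt)
      (fun s _ => (hf s).hasDerivWithinAt) ?_ hB ?_ (Set.right_mem_Icc.2 hr)
    · simp [f, propagator]
    · intro s hs
      simp only [f', norm_neg]
      rw [CStarRing.norm_mul_mem_unitary _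
          (Unitary.star_mem (propagator_mem_unitary hK₂ hV₂ s)),
        CStarRing.norm_mem_unitary_mul _ (propagator_mem_unitary hK₁ hV₁ s)]
      exact h s hs.1 hs.2.le
  have e : propagator K₁ V₁ r - propagator K₂ V₂ r = f r * propagator K₂ V₂ r := by
    simp only [f, sub_mul, mul_assoc, one_mul,
      Unitary.star_mul_self_of_mem (propagator_mem_unitary hK₂ hV₂ r), mul_one]
  rw [e, CStarRing.norm_mul_mem_unitary _ (propagator_mem_unitary hK₂ hV₂ r)]
  exact hfr

/-- Evolution by `K - V` fixes `O` and can be inserted for free, so only the propagator generated by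
`V` matters. -/
theorem heisenberg_eq_of_commute {K V O : 𝔸} (hK : K ∈ skewAdjoint 𝔸)
    (hV : V ∈ skewAdjoint 𝔸) (h : Commute (K - V) O) (s : ℝ) :
    heisenberg K s O = star (propagator K V s) * O * propagator K V s := by
  have e := heisenberg_of_commute h.neg_left s
  rw [heisenberg, neg_neg, neg_sub] at e
  rw [star_propagator hK hV, propagator, heisenberg]
  conv_lhs => rw [← e]
  simp only [mul_assoc]

theorem norm_heisenberg_sub_le {K₁ K₂ V O : 𝔸} (hK₁ : K₁ ∈ skewAdjoint 𝔸)
    (hK₂ : K₂ ∈ skewAdjoint 𝔸) (hV : V ∈ skewAdjoint 𝔸) (h₁ : Commute (K₁ - V) O)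
    (h₂ : Commute (K₂ - V) O) (s : ℝ) :
    ‖heisenberg K₁ s O - heisenberg K₂ s O‖
      ≤ 2 * ‖O‖ * ‖propagator K₁ V s - propagator K₂ V s‖ := by
  rw [heisenberg_eq_of_commute hK₁ hV h₁, heisenberg_eq_of_commute hK₂ hV h₂]
  have u₁ := propagator_mem_unitary hK₁ hV s
  have u₂ := propagator_mem_unitary hK₂ hV s
  generalize propagator K₁ V s = P at *
  generalize propagator K₂ V s = Q at *
  have e : star P * O * P - star Q * O * Q = star (P - Q) * O * P + star Q * (O * (P - Q)) := by
    rw [star_sub]; noncomm_ring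
  rw [e]
  refine (norm_add_le _ _).trans ?_
  rw [CStarRing.norm_mul_mem_unitary _ u₁, CStarRing.norm_mem_unitary_mul _ (Unitary.star_mem u₂)]
  have h1 := norm_mul_le (star (P - Q)) O
  rw [norm_star] at h1
  have h2 := norm_mul_le O (P - Q)
  linarith

end CStar

/-! ### Lattice geometry -/

section Geometry

variable {D : ℕ}

theorem siteDist_comm (u v : Site D) : siteDist u v = siteDist v u := by
  unfold siteDist
  exact Finset.sum_congr rfl fun i _ => by omega

theorem siteDist_triangle (u v w : Site D) : siteDist u w ≤ siteDist u v + siteDist v w := by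
  unfold siteDist
  rw [← Finset.sum_add_distrib]
  exact Finset.sum_le_sum fun i _ => by omega

theorem regionDist_le_siteDist {Γ : Finset (Site D)} {A C : Finset Γ} {a c : Γ} (ha : a ∈ A)
    (hc : c ∈ C) : regionDist A C ≤ siteDist (a : Site D) (c : Site D) :=
  Nat.sInf_le ⟨a, ha, c, hc, rfl⟩

theorem card_filter_siteDist_le_two {Γ : Finset (Site D)} (x : Site D) :
    (Finset.univ.filter fun z : Γ => siteDist x (z : Site D) ≤ 2).card ≤ 5 ^ D := by
  have h5 : (Fintype.piFinset fun _ : Fin D => Finset.Icc (-2 : ℤ) 2).card = 5 ^ D := by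
    simp
  rw [← h5]
  refine Finset.card_le_card_of_injOn (fun z => fun i => (z : Site D) i - x i) ?_ ?_
  · intro z hz
    simp only [Finset.coe_filter, Finset.mem_univ, true_and, Set.mem_ofPred_eq] at hz
    simp only [Finset.mem_coe, Fintype.mem_piFinset, Finset.mem_Icc]
    intro i
    have hi : (x i - (z : Site D) i).natAbs ≤ siteDist x (z : Site D) :=
      Finset.single_le_sum (f := fun i => (x i - (z : Site D) i).natAbs)
        (fun _ _ => Nat.zero_le _) (Finset.mem_univ i)
    omega
  · intro z _ w _ h
    refine Subtype.ext (funext fun i => ?_)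
    have := congrFun h i
    simpa using this

end Geometry

/-! ### Locality of operators -/

theorem IsSupportedOn.commute {D q : ℕ} {Γ : Finset (Site D)} {X Y : Finset Γ}
    {M N : Operator Γ q} (hM : IsSupportedOn X M) (hN : IsSupportedOn Y N)
    (hXY : Disjoint X Y) : Commute M N := by
  have product : ∀ {X Y : Finset Γ} {M N : Operator Γ q}, IsSupportedOn X M → IsSupportedOn Y N →
      Disjoint X Y → ∀ σ ρ, (M * N) σ ρ = M σ (fun x => if x ∈ X then ρ x else σ x)
        * N (fun x => if x ∈ X then ρ x else σ x) ρ := by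
    intro X Y M N hM hN hXY σ ρ
    obtain ⟨h, hM⟩ := hM
    obtain ⟨g, hN⟩ := hN
    rw [Matrix.mul_apply]
    -- `M` changes only sites in `X` and `N` only sites outside `X`, so the intermediate
    -- configuration is forced.
    refine Finset.sum_eq_single _ (fun τ _ hτ => ?_) (by simp)
    by_contra hne
    refine hτ (funext fun x => ?_)
    split_ifs with hx
    · by_contra hx'
      exact hne (by rw [(hN τ ρ).2 ⟨x, Finset.disjoint_left.1 hXY hx, hx'⟩, mul_zero])
    · by_contra hx'
      exact hne (by rw [(hM σ τ).2 ⟨x, hx, fun e => hx' e.symm⟩, zero_mul])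
  ext σ ρ
  rw [product hM hN hXY, product hN hM hXY.symm]
  obtain ⟨h, hM⟩ := hM
  obtain ⟨g, hN⟩ := hN
  by_cases hout : ∀ x, x ∉ X → x ∉ Y → σ x = ρ x
  · rw [mul_comm]
    congr 1
    · rw [(hN _ _).1, (hN _ _).1]
      · congr 1
        · funext x
          simp [Finset.disjoint_right.1 hXY x.2]
        · funext x
          simp
      · intro x hx; simp [hx]
      · intro x hx
        by_cases hxX : x ∈ X
        · simp [hxX]
        · simp [hxX, hout x hxX hx]
    · rw [(hM _ _).1, (hM _ _).1]
      · congr 1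
        · funext x
          simp [Finset.disjoint_left.1 hXY x.2]
        · funext x
          simp
      · intro x hx
        by_cases hxY : x ∈ Y
        · simp [hxY]
        · simp [hxY, hout x hx hxY]
      · intro x hx; simp [hx]
  · push Not at hout
    obtain ⟨x, hX, hY, hx⟩ := hout
    rw [(hN _ ρ).2 ⟨x, hY, by simpa [hX] using hx⟩,
      (hM (fun x => if x ∈ Y then ρ x else σ x) ρ).2 ⟨x, hX, by simpa [hY] using hx⟩]
    simp

/-! ### Generators of local evolutions and the Lieb–Robinson bound -/

namespace LocalHamiltonian

variable {D q : ℕ} {Γ : Finset (Site D)} (H : LocalHamiltonian Γ q)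

theorem siteDist_le_one_of_term_ne_zero {X : Finset Γ} (hX : H.term X ≠ 0) {x y : Γ}
    (hx : x ∈ X) (hy : y ∈ X) : siteDist (x : Site D) (y : Site D) ≤ 1 := by
  by_contra h
  exact hX (H.range_one X ⟨x, hx, y, hy, not_le.1 h⟩)

/-- The skew-adjoint operator `i t ∑_{X ∈ F} H_X`. -/
def skewSum (t : ℝ) (F : Finset (Finset Γ)) : Operator Γ q :=
  (Complex.I * (t : ℂ)) • ∑ X ∈ F, H.term X

theorem skewSum_mem_skewAdjoint (t : ℝ) (F : Finset (Finset Γ)) :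
    H.skewSum t F ∈ skewAdjoint (Operator Γ q) := by
  have h : star (∑ X ∈ F, H.term X) = ∑ X ∈ F, H.term X := by
    rw [star_sum]
    exact Finset.sum_congr rfl fun X _ => H.isHermitian X
  rw [skewAdjoint.mem_iff, skewSum, star_smul, h, ← neg_smul]
  congr 1
  simp

theorem evolution_eq_exp (t : ℝ) (Y : Finset Γ) :
    H.evolution t Y = NormedSpace.exp ((1 : ℝ) • (-H.skewSum t Y.powerset)) := by
  rw [evolution, restrict, skewSum, one_smul, neg_smul]

theorem evolution_mem_unitaryGroup (t : ℝ) (Y : Finset Γ) :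
    H.evolution t Y ∈ Matrix.unitaryGroup (Config Γ q) ℂ := by
  rw [evolution_eq_exp]
  exact exp_smul_mem_unitary (neg_mem (H.skewSum_mem_skewAdjoint t _)) 1

theorem conjTranspose_evolution (t : ℝ) (Y : Finset Γ) :
    (H.evolution t Y).conjTranspose = NormedSpace.exp ((1 : ℝ) • H.skewSum t Y.powerset) := by
  rw [evolution_eq_exp, ← Matrix.star_eq_conjTranspose,
    star_exp_smul (neg_mem (H.skewSum_mem_skewAdjoint t _)), neg_neg]

theorem commute_skewSum {t : ℝ} {F : Finset (Finset Γ)} {O : Operator Γ q}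
    (h : ∀ Z ∈ F, Commute (H.term Z) O) : Commute (H.skewSum t F) O :=
  (Commute.sum_left _ _ _ h).smul_left _

theorem skewSum_sub_skewSum (t : ℝ) {F G : Finset (Finset Γ)} (h : G ⊆ F) :
    H.skewSum t F - H.skewSum t G = H.skewSum t (F \ G) := by
  rw [skewSum, skewSum, skewSum, ← smul_sub, ← Finset.sum_sdiff h, add_sub_cancel_right]

theorem heisenberg_skewSum (K : Operator Γ q) (s t : ℝ) (F : Finset (Finset Γ)) :
    heisenberg K s (H.skewSum t F)
      = (Complex.I * (t : ℂ)) • ∑ X ∈ F, heisenberg K s (H.term X) := by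
  rw [skewSum, heisenberg_smul, heisenberg_sum]

open Classical in
/-- The regions `Z ⊆ Y` meeting `X` with `H_Z ≠ 0`. -/
def touching (Y X : Finset Γ) : Finset (Finset Γ) :=
  Y.powerset.filter fun Z => ¬ Disjoint Z X ∧ H.term Z ≠ 0

theorem mem_touching {Y X Z : Finset Γ} :
    Z ∈ H.touching Y X ↔ Z ⊆ Y ∧ ¬ Disjoint Z X ∧ H.term Z ≠ 0 := by
  simp [touching]

theorem card_touching_le (Y : Finset Γ) {X : Finset Γ}
    (hX : ∀ x ∈ X, ∀ y ∈ X, siteDist (x : Site D) (y : Site D) ≤ 1) :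
    (H.touching Y X).card ≤ 2 ^ 5 ^ D := by
  rcases X.eq_empty_or_nonempty with rfl | ⟨x, hx⟩
  · simp [touching]
  · calc (H.touching Y X).card
        ≤ (Finset.univ.filter fun z : Γ => siteDist (x : Site D) z ≤ 2).powerset.card := by
          refine Finset.card_le_card fun Z hZ => ?_
          obtain ⟨-, hZX, hZ0⟩ := H.mem_touching.1 hZ
          obtain ⟨z, hz, hzX⟩ := Finset.not_disjoint_iff.1 hZX
          refine Finset.mem_powerset.2 fun w hw => ?_
          simp only [Finset.mem_filter, Finset.mem_univ, true_and]
          have h1 := H.siteDist_le_one_of_term_ne_zero hZ0 hz hw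
          have h2 := hX x hx z hzX
          have h3 := siteDist_triangle (x : Site D) z w
          omega
      _ ≤ 2 ^ 5 ^ D := by
          rw [Finset.card_powerset]
          exact Nat.pow_le_pow_right two_pos (card_filter_siteDist_le_two _)

theorem commute_skewSum_sub_touching (t : ℝ) (Y : Finset Γ) {X : Finset Γ} {O : Operator Γ q}
    (hO : IsSupportedOn X O) :
    Commute (H.skewSum t Y.powerset - H.skewSum t (H.touching Y X)) O := by
  have hsub : H.touching Y X ⊆ Y.powerset := Finset.filter_subset _ _
  rw [skewSum_sub_skewSum _ _ hsub]
  refine H.commute_skewSum fun Z hZ => ?_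
  rw [Finset.mem_sdiff, Finset.mem_powerset, mem_touching] at hZ
  by_cases h0 : H.term Z = 0
  · rw [h0]; exact Commute.zero_left _
  · have hd : Disjoint Z X := by
      by_contra h
      exact hZ.2 ⟨hZ.1, h, h0⟩
    exact (H.supported Z).commute hO hd

/-- Lieb–Robinson type bound: for an operator supported at distance more than `n` from `A`, the
Heisenberg evolutions with and without the terms touching `A` agree up to an error of order `n`. -/
theorem norm_heisenberg_union_sub_le (t : ℝ) (A B : Finset Γ) (n : ℕ) :
    ∀ X : Finset Γ, (∀ x ∈ X, ∀ y ∈ X, siteDist (x : Site D) (y : Site D) ≤ 1) →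
      (∀ x ∈ X, ∀ a ∈ A, n < siteDist (x : Site D) (a : Site D)) →
      ∀ O : Operator Γ q, IsSupportedOn X O → ∀ s : ℝ, 0 ≤ s →
        ‖heisenberg (H.skewSum t (A ∪ B).powerset) s O - heisenberg (H.skewSum t B.powerset) s O‖
          ≤ 2 * ‖O‖ * ((2 * 2 ^ 5 ^ D * |t| * s) ^ n / n.factorial) := by
  induction n with
  | zero =>
    intro X _ _ O _ s _
    have h1 := norm_sub_le (heisenberg (H.skewSum t (A ∪ B).powerset) s O)
      (heisenberg (H.skewSum t B.powerset) s O)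
    rw [norm_heisenberg (H.skewSum_mem_skewAdjoint t _),
      norm_heisenberg (H.skewSum_mem_skewAdjoint t _)] at h1
    simp only [pow_zero, Nat.factorial_zero, Nat.cast_one, div_one, mul_one]
    linarith
  | succ n ih =>
    intro X hX hXA O hO s hs
    have hfar : ∀ Z, ¬ Disjoint Z X → H.term Z ≠ 0 →
        ∀ z ∈ Z, ∀ a ∈ A, n < siteDist (z : Site D) (a : Site D) := by
      intro Z hZX hZ0 z hz a ha
      obtain ⟨w, hw, hwX⟩ := Finset.not_disjoint_iff.1 hZX
      have h1 := H.siteDist_le_one_of_term_ne_zero hZ0 hw hz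
      have h2 := hXA w hwX a ha
      have h3 := siteDist_triangle (w : Site D) z a
      omega
    -- Nonzero terms touching `X` cannot reach `A`, so both evolutions share the same perturbation
    -- `V`.
    have htouch : H.touching (A ∪ B) X = H.touching B X := by
      ext Z
      simp only [mem_touching]
      refine ⟨fun ⟨h1, h2, h3⟩ => ⟨fun z hz => ?_, h2, h3⟩,
        fun ⟨h1, h2, h3⟩ => ⟨h1.trans Finset.subset_union_right, h2, h3⟩⟩
      refine (Finset.mem_union.1 (h1 hz)).resolve_left fun hzA => ?_
      have := hfar Z h2 h3 z hz z hzA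
      simp [siteDist] at this
    have c₁ := H.commute_skewSum_sub_touching t (A ∪ B) hO
    have c₂ := H.commute_skewSum_sub_touching t B hO
    rw [htouch] at c₁
    refine (norm_heisenberg_sub_le (H.skewSum_mem_skewAdjoint t _) (H.skewSum_mem_skewAdjoint t _)
      (H.skewSum_mem_skewAdjoint t _) c₁ c₂ s).trans ?_
    refine mul_le_mul_of_nonneg_left ?_ (by positivity)
    have hprop := norm_propagator_sub_le (m := n) (r := s)
      -- At most `2 ^ 5 ^ D` touching terms, each of norm at most 1 and controlled by the induction
      -- hypothesis.
      (c := |t| * (2 ^ 5 ^ D * (2 * ((2 * 2 ^ 5 ^ D * |t|) ^ n / n.factorial))))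
      (H.skewSum_mem_skewAdjoint t (A ∪ B).powerset) (H.skewSum_mem_skewAdjoint t B.powerset)
      (H.skewSum_mem_skewAdjoint t (H.touching B X))
      (H.skewSum_mem_skewAdjoint t (H.touching B X)) hs ?_
    · refine hprop.trans (le_of_eq ?_)
      rw [Nat.factorial_succ]
      push_cast
      have : (n.factorial : ℝ) ≠ 0 := by positivity
      have : (n : ℝ) + 1 ≠ 0 := by positivity
      field_simp
      ring
    · intro r hr _
      rw [heisenberg_skewSum, heisenberg_skewSum, ← smul_sub, ← Finset.sum_sub_distrib, norm_smul]
      have hnt : ‖Complex.I * (t : ℂ)‖ = |t| := by simp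
      rw [hnt, mul_assoc]
      refine mul_le_mul_of_nonneg_left ?_ (abs_nonneg t)
      have hterm : ∀ Z ∈ H.touching B X,
          ‖heisenberg (H.skewSum t (A ∪ B).powerset) r (H.term Z)
            - heisenberg (H.skewSum t B.powerset) r (H.term Z)‖
          ≤ 2 * ((2 * 2 ^ 5 ^ D * |t|) ^ n / n.factorial) * r ^ n := by
        intro Z hZ
        obtain ⟨-, hZX, hZ0⟩ := H.mem_touching.1 hZ
        refine (ih Z (fun x hx y hy => H.siteDist_le_one_of_term_ne_zero hZ0 hx hy)
          (hfar Z hZX hZ0) _ (H.supported Z) r hr).trans ?_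
        calc _ ≤ 2 * 1 * ((2 * 2 ^ 5 ^ D * |t| * r) ^ n / n.factorial) := by
              gcongr
              exact H.norm_le_one Z
          _ = _ := by rw [mul_pow _ r]; ring
      refine (norm_sum_le_of_le _ hterm).trans ?_
      rw [Finset.sum_const, nsmul_eq_mul, mul_assoc (2 ^ 5 ^ D : ℝ)]
      refine mul_le_mul_of_nonneg_right ?_ (by positivity)
      exact_mod_cast H.card_touching_le B hX

/-- The regions counted in `boundaryNorm A B C`: all `X ⊆ A ∪ B ∪ C` with `X ⊄ A ∪ B`
and `X ⊄ C`. -/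
def boundary (A B C : Finset Γ) : Finset (Finset Γ) :=
  (A ∪ B ∪ C).powerset.filter fun X => ¬ X ⊆ A ∪ B ∧ ¬ X ⊆ C

theorem mem_boundary {A B C X : Finset Γ} :
    X ∈ boundary A B C ↔ X ⊆ A ∪ B ∪ C ∧ ¬ X ⊆ A ∪ B ∧ ¬ X ⊆ C := by
  rw [boundary, Finset.mem_filter, Finset.mem_powerset]

theorem boundaryNorm_eq_sum (A B C : Finset Γ) :
    H.boundaryNorm A B C = ∑ X ∈ boundary A B C, ‖H.term X‖ := rfl

theorem boundaryNorm_nonneg (A B C : Finset Γ) : 0 ≤ H.boundaryNorm A B C :=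
  Finset.sum_nonneg fun _ _ => norm_nonneg _

theorem boundary_empty_subset {A B C : Finset Γ} (hAC : Disjoint A C) :
    boundary ∅ B C ⊆ boundary A B C := by
  intro X hX
  rw [mem_boundary, Finset.empty_union] at hX
  obtain ⟨h1, h2, h3⟩ := hX
  rw [mem_boundary]
  refine ⟨fun x hx => ?_, fun h => h2 fun x hx => ?_, h3⟩
  · have := h1 hx
    simp only [Finset.mem_union] at this ⊢
    tauto
  · have h4 := h1 hx
    have h5 := h hx
    rw [Finset.mem_union] at h4 h5
    have h6 : x ∈ A → x ∉ C := fun h => Finset.disjoint_left.1 hAC h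
    tauto

/-- The generator of `C`, seen from `A ∪ B`, splits into the interior of `C` and the boundary. -/
theorem skewSum_powerset_sub (t : ℝ) (A B C : Finset Γ) :
    H.skewSum t (A ∪ B).powerset - H.skewSum t (A ∪ B ∪ C).powerset
      = -(H.skewSum t (C.powerset.filter fun X => ¬ X ⊆ A ∪ B) + H.skewSum t (boundary A B C)) := by
  rw [← neg_sub, H.skewSum_sub_skewSum t (Finset.powerset_mono.2 Finset.subset_union_left)]
  congr 1
  rw [skewSum, skewSum, skewSum, ← smul_add, ← Finset.sum_union]
  · congr 2
    ext X
    simp only [Finset.mem_sdiff, Finset.mem_powerset, Finset.mem_union, Finset.mem_filter,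
      mem_boundary]
    have : X ⊆ C → X ⊆ A ∪ B ∪ C := fun h => h.trans Finset.subset_union_right
    tauto
  · refine Finset.disjoint_left.2 fun X h1 h2 => ?_
    exact (mem_boundary.1 h2).2.2 (Finset.mem_powerset.1 (Finset.mem_filter.1 h1).1)

theorem heisenberg_interior {A C : Finset Γ} (hAC : Disjoint A C) (s t : ℝ)
    (F : Finset (Finset Γ)) (hF : ∀ X ∈ F, X ⊆ C) :
    heisenberg (H.skewSum t A.powerset) s (H.skewSum t F) = H.skewSum t F := by
  refine heisenberg_of_commute (H.commute_skewSum fun Z hZ => ?_) s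
  refine (H.commute_skewSum fun X hX => ?_).symm
  refine (H.supported X).commute (H.supported Z) ?_
  exact Finset.disjoint_of_subset_left (hF X hX)
    (Finset.disjoint_of_subset_right (Finset.mem_powerset.1 hZ) hAC.symm)

/-- Factoring out the unitary `U_AB` and taking adjoints preserves the norm and produces the two
propagators. -/
theorem norm_evolution_sub_eq (t : ℝ) (A B C : Finset Γ) :
    ‖H.evolution t (A ∪ B) * (H.evolution t B).conjTranspose * H.evolution t (B ∪ C)
        - H.evolution t (A ∪ B ∪ C)‖
      = ‖propagator (H.skewSum t (A ∪ B).powerset)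
            (H.skewSum t (A ∪ B).powerset - H.skewSum t (A ∪ B ∪ C).powerset) 1
          - propagator (H.skewSum t B.powerset)
            (H.skewSum t B.powerset - H.skewSum t (B ∪ C).powerset) 1‖ := by
  have hu := H.evolution_mem_unitaryGroup t (A ∪ B)
  have e : H.evolution t (A ∪ B) * (H.evolution t B).conjTranspose * H.evolution t (B ∪ C)
        - H.evolution t (A ∪ B ∪ C)
      = H.evolution t (A ∪ B) * ((H.evolution t B).conjTranspose * H.evolution t (B ∪ C)
        - (H.evolution t (A ∪ B)).conjTranspose * H.evolution t (A ∪ B ∪ C)) := by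
    rw [mul_sub, ← mul_assoc (H.evolution t (A ∪ B)) (H.evolution t (A ∪ B)).conjTranspose,
      ← Matrix.star_eq_conjTranspose (H.evolution t (A ∪ B)), Matrix.mem_unitaryGroup_iff.1 hu,
      one_mul, mul_assoc]
  rw [e, CStarRing.norm_mem_unitary_mul _ hu, norm_sub_rev, ← norm_star]
  congr 1
  simp only [propagator, sub_sub_cancel, star_sub, star_mul, ← Matrix.star_eq_conjTranspose,
    star_star]
  simp only [Matrix.star_eq_conjTranspose, conjTranspose_evolution]
  rw [evolution_eq_exp, evolution_eq_exp]

theorem norm_evolution_sub_le (t : ℝ) {A B C : Finset Γ} (hAC : Disjoint A C)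
    (hBC : Disjoint B C) :
    ‖H.evolution t (A ∪ B) * (H.evolution t B).conjTranspose * H.evolution t (B ∪ C)
        - H.evolution t (A ∪ B ∪ C)‖
      ≤ 2 * |t| * Real.exp (2 * 2 ^ 5 ^ D * |t| * Real.exp 1 + 2)
        * Real.exp (-(regionDist A C : ℝ)) * H.boundaryNorm A B C := by
  rw [norm_evolution_sub_eq]
  have hABC : Disjoint (A ∪ B) C := Finset.disjoint_union_left.2 ⟨hAC, hBC⟩
  set d := regionDist A C with hd
  set x : ℝ := 2 * 2 ^ 5 ^ D * |t| with hx
  have hx0 : 0 ≤ x := by positivity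
  have hS := H.boundaryNorm_nonneg A B C
  have hV₂ := H.skewSum_powerset_sub t ∅ B C
  rw [Finset.empty_union] at hV₂
  have hV₁ := H.skewSum_powerset_sub t A B C
  -- By disjointness, both conditions exclude only the empty set.
  have hint : (C.powerset.filter fun X => ¬ X ⊆ B) = C.powerset.filter fun X => ¬ X ⊆ A ∪ B := by
    refine Finset.filter_congr fun X hX => not_congr ⟨fun h => h.trans Finset.subset_union_right,
      fun h y hy => ?_⟩
    exact absurd (Finset.mem_powerset.1 hX hy) (Finset.disjoint_left.1 hABC (h hy))
  have main : ∀ s : ℝ, 0 ≤ s → s ≤ 1 →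
      ‖∑ X ∈ boundary A B C, heisenberg (H.skewSum t (A ∪ B).powerset) s (H.term X)
        - ∑ X ∈ boundary ∅ B C, heisenberg (H.skewSum t B.powerset) s (H.term X)‖
      ≤ 2 * Real.exp (x * Real.exp 1 + 2) * Real.exp (-(d : ℝ)) * H.boundaryNorm A B C := by
    intro s hs0 hs1
    by_cases hd2 : 2 ≤ d
    -- Here `n = d - 2`: a nonzero boundary term contains a site of `C` and has diameter at most 1,
    -- so its sites are at distance at least `d - 1 > n` from `A`.
    · obtain ⟨n, hn⟩ := Nat.exists_eq_add_of_le hd2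
      -- Such `X` meets both `A` and `C`, too far apart for a nonzero term.
      have hzero : ∀ X ∈ boundary A B C, X ∉ boundary ∅ B C →
          heisenberg (H.skewSum t B.powerset) s (H.term X) = 0 := by
        intro X hX hX'
        obtain ⟨h1, h2, h3⟩ := mem_boundary.1 hX
        obtain ⟨c, hcX, hc⟩ := Finset.not_subset.1 h2
        have hcC : c ∈ C := (Finset.mem_union.1 (h1 hcX)).resolve_left hc
        have hXBC : ¬ X ⊆ B ∪ C := by
          intro h
          refine hX' (mem_boundary.2 ?_)
          rw [Finset.empty_union]
          exact ⟨h, fun h' => h2 (h'.trans Finset.subset_union_right), h3⟩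
        obtain ⟨a, haX, ha⟩ := Finset.not_subset.1 hXBC
        have haA : a ∈ A := by
          have := h1 haX
          simp only [Finset.mem_union] at this ha
          tauto
        have h0 : H.term X = 0 := by
          refine H.range_one X ⟨a, haX, c, hcX, ?_⟩
          have := regionDist_le_siteDist haA hcC
          omega
        rw [h0, heisenberg, mul_zero, zero_mul]
      rw [Finset.sum_subset (boundary_empty_subset hAC) hzero, ← Finset.sum_sub_distrib]
      have hpow : x ^ n / n.factorial ≤ Real.exp (x * Real.exp 1 + 2) * Real.exp (-(d : ℝ)) := by
        have h := Real.pow_div_factorial_le_exp (x := x * Real.exp 1) (by positivity) n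
        rw [mul_pow, ← Real.exp_nat_mul, mul_one] at h
        have hdn : (d : ℝ) = 2 + n := by rw [hn]; push_cast; ring
        have e1 : Real.exp (x * Real.exp 1 + 2) * Real.exp (-(d : ℝ))
            = Real.exp (x * Real.exp 1) * Real.exp (-(n : ℝ)) := by
          rw [← Real.exp_add, ← Real.exp_add, hdn]; congr 1; ring
        rw [e1]
        calc x ^ n / n.factorial
            = (x ^ n * Real.exp n / n.factorial) * Real.exp (-(n : ℝ)) := by
              rw [Real.exp_neg]
              field_simp
          _ ≤ _ := mul_le_mul_of_nonneg_right h (Real.exp_pos _).le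
      rw [boundaryNorm_eq_sum, Finset.mul_sum]
      refine norm_sum_le_of_le _ fun X hX => ?_
      obtain ⟨h1, h2, h3⟩ := mem_boundary.1 hX
      obtain ⟨c, hcX, hc⟩ := Finset.not_subset.1 h2
      have hcC : c ∈ C := (Finset.mem_union.1 (h1 hcX)).resolve_left hc
      by_cases h0 : H.term X = 0
      · simp [h0, heisenberg]
      refine (H.norm_heisenberg_union_sub_le t A B n X
        (fun y hy z hz => H.siteDist_le_one_of_term_ne_zero h0 hy hz) (fun y hy a ha => ?_) _
        (H.supported X) s hs0).trans ?_
      · have i1 := H.siteDist_le_one_of_term_ne_zero h0 hy hcX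
        have i2 := regionDist_le_siteDist ha hcC
        have i3 := siteDist_triangle (a : Site D) y c
        rw [siteDist_comm (a : Site D) y] at i3
        omega
      · calc _ ≤ 2 * ‖H.term X‖ * (x ^ n / n.factorial) := by
              rw [← hx]
              have : x * s ≤ x := mul_le_of_le_one_right hx0 hs1
              gcongr
          _ ≤ 2 * ‖H.term X‖ * (Real.exp (x * Real.exp 1 + 2) * Real.exp (-(d : ℝ))) := by
              gcongr
          _ = _ := by ring
    -- For `d < 2`, including empty `A` or `C`, the triangle inequality suffices: the `+ 2` in the
    -- exponent absorbs `exp (-d)`.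
    · have hsum : ∀ F ⊆ boundary A B C, ∀ Y : Finset Γ,
          ‖∑ X ∈ F, heisenberg (H.skewSum t Y.powerset) s (H.term X)‖
            ≤ H.boundaryNorm A B C := by
        intro F hF Y
        refine (norm_sum_le_of_le _ fun X _ =>
          (norm_heisenberg (H.skewSum_mem_skewAdjoint t _) s (H.term X)).le).trans ?_
        exact Finset.sum_le_sum_of_subset_of_nonneg hF fun _ _ _ => norm_nonneg _
      have i1 := hsum _ subset_rfl (A ∪ B)
      have i2 := hsum _ (boundary_empty_subset hAC) B
      refine (norm_sub_le _ _).trans ((add_le_add i1 i2).trans ?_)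
      have hd1 : (d : ℝ) ≤ 2 := by exact_mod_cast (not_le.1 hd2).le
      have h1 : 1 ≤ Real.exp (x * Real.exp 1 + 2) * Real.exp (-(d : ℝ)) := by
        rw [← Real.exp_add, Real.one_le_exp_iff]
        have : 0 ≤ x * Real.exp 1 := by positivity
        linarith
      nlinarith
  have hprop := norm_propagator_sub_le (m := 0) (r := 1)
    (c := |t| * (2 * Real.exp (x * Real.exp 1 + 2) * Real.exp (-(d : ℝ)) * H.boundaryNorm A B C))
    (H.skewSum_mem_skewAdjoint t (A ∪ B).powerset) (H.skewSum_mem_skewAdjoint t B.powerset)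
    (sub_mem (H.skewSum_mem_skewAdjoint t (A ∪ B).powerset)
      (H.skewSum_mem_skewAdjoint t (A ∪ B ∪ C).powerset))
    (sub_mem (H.skewSum_mem_skewAdjoint t B.powerset)
      (H.skewSum_mem_skewAdjoint t (B ∪ C).powerset)) zero_le_one ?_
  · refine hprop.trans (le_of_eq ?_)
    push_cast
    ring
  · intro s hs0 hs1
    have hF : ∀ X ∈ C.powerset.filter fun X => ¬ X ⊆ A ∪ B, X ⊆ C := fun X hX =>
      Finset.mem_powerset.1 (Finset.mem_filter.1 hX).1
    rw [hV₁, hV₂, hint, heisenberg_neg, heisenberg_neg, heisenberg_add, heisenberg_add,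
      H.heisenberg_interior hABC s t _ hF, H.heisenberg_interior hBC s t _ hF, ← neg_sub',
      norm_neg, add_sub_add_left_eq_sub, heisenberg_skewSum, heisenberg_skewSum, ← smul_sub,
      norm_smul, pow_zero, mul_one]
    have hnt : ‖Complex.I * (t : ℂ)‖ = |t| := by simp
    rw [hnt]
    exact mul_le_mul_of_nonneg_left (main s hs0 hs1) (abs_nonneg t)

end LocalHamiltonian

end LocalEvolution

end

theorem mainTheorem6 (D : ℕ) :
    (∃ μ : ℝ, 0 < μ ∧ ∀ t : ℝ, ∃ K : ℝ, 0 < K ∧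
      ∀ (Γ : Finset (LocalEvolution.Site D)) (q : ℕ) (H : LocalEvolution.LocalHamiltonian Γ q)
        (A B C : Finset Γ), Disjoint A B → Disjoint A C → Disjoint B C →
        LocalEvolution.diamondNorm
            (LocalEvolution.conjChannel (H.evolution t (A ∪ B))
                ∘ₗ LocalEvolution.conjChannel (H.evolution t B).conjTranspose
                ∘ₗ LocalEvolution.conjChannel (H.evolution t (B ∪ C))
              - LocalEvolution.conjChannel (H.evolution t (A ∪ B ∪ C)))
          ≤ ENNReal.ofReal
              (K * Real.exp (-μ * (LocalEvolution.regionDist A C : ℝ)) * H.boundaryNorm A B C)) ∧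
    (∀ (n : Type) [Fintype n] [DecidableEq n] (U V : Matrix n n ℂ),
      U ∈ Matrix.unitaryGroup n ℂ → V ∈ Matrix.unitaryGroup n ℂ →
        LocalEvolution.diamondNorm
            (LocalEvolution.conjChannel U - LocalEvolution.conjChannel V)
          ≤ ENNReal.ofReal (2 * ‖U - V‖)) := by
  refine ⟨⟨1, one_pos, fun t =>
    -- Twice the constant of `norm_evolution_sub_le`, with `|t| + 1` for `|t|` to stay positive at
    -- `t = 0`.
    ⟨4 * (|t| + 1) * Real.exp (2 * 2 ^ 5 ^ D * |t| * Real.exp 1 + 2), by positivity,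
      fun Γ q H A B C _ hAC hBC => ?_⟩⟩,
    fun n _ _ U V hU hV => LocalEvolution.diamondNorm_conjChannel_sub_le hU hV⟩
  rw [LocalEvolution.conjChannel_comp, LocalEvolution.conjChannel_comp, ← mul_assoc]
  refine (LocalEvolution.diamondNorm_conjChannel_sub_le
    (mul_mem (mul_mem (H.evolution_mem_unitaryGroup t _)
      (Unitary.star_mem (H.evolution_mem_unitaryGroup t B)))
      (H.evolution_mem_unitaryGroup t _))
    (H.evolution_mem_unitaryGroup t _)).trans (ENNReal.ofReal_le_ofReal ?_)
  refine (mul_le_mul_of_nonneg_left (H.norm_evolution_sub_le t hAC hBC) zero_le_two).trans ?_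
  have hS := H.boundaryNorm_nonneg A B C
  rw [neg_one_mul]
  calc _ = 4 * |t| * Real.exp (2 * 2 ^ 5 ^ D * |t| * Real.exp 1 + 2)
        * Real.exp (-(LocalEvolution.regionDist A C : ℝ)) * H.boundaryNorm A B C := by ring
    _ ≤ _ := by
        gcongr
        linarith
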